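/- An ordered reflexive directed graph is a structure $\mathcal G=(V,\le,\rho)$ where $\le$ is a linear order on $V$ and $\rho$ is a reflexive binary relation on $V$. Its profile $\varphi_{\mathcal G}$ counts, for each $n\ge 0$, the induced substructures of $\mathcal G$ on $n$-element subsets of $V$ up to isomorphism (isomorphisms preserve both $\le$ and $\rho$). For distinct vertices $x,y$ write $d(x,y)=0,+,-,\pm$ according to whether $\rho$ contains neither of $(x,y),(y,x)$, only $(x,y)$, only $(y,x)$, or both. The dual of a structure has the same order and every $+$ exchanged with $-$. Put $A=\mathbb N\times\{0\}$ and $B=\mathbb N\times\{1\}$. Let $\check{\mathfrak A}_1$ be the set of the following 1242 ordered reflexive directed graphs $\mathcal G^{(p)}_{\ell,k}$ with $1\le p\le 10$, $1\le\ell\le 6$. The vertex set is $A\cup B$ or, where indicated, $A\cup B\cup\{a\}$. All loops are present. The other edges are given by $\alpha=d((n,0),(m,0))$ and $\beta=d((n,1),(m,1))$ for $n<m$; by the triple $(u,v,w)$ where $u=d((n,0),(n,1))$, $v=d((n,0),(m,1))$ for $n<m$, and $w=d((n,0),(m,1))$ for $n>m$; and, if $a$ is present, by the pair $(d(a,(n,0)),d(a,(n,1)))$.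 Order. For $\ell=1$: $(0,0)<(0,1)<(1,0)<(1,1)<\cdots$, with $a$ least; for $\ell=2$: the reverse order. For $\ell=3,4,5,6$: every element of $A$ precedes every element of $B$, and, according to the first coordinate, $(A,B)$ is ordered as $(\omega,\omega)$, $(\omega^*,\omega)$, $(\omega,\omega^*)$, $(\omega^*,\omega^*)$ respectively. Triples. $c_1=(+,0,0)$, $c_2=(-,0,0)$, $c_3=(\pm,0,0)$, $c_4=(+,+,0)$, $c_5=(-,-,0)$, $c_6=(\pm,\pm,0)$, $c_7=(+,+,+)$, $c_8=(+,+,\pm)$, $c_9=(-,-,\pm)$, $c_{10}=(+,+,-)$, $c_{11}=(-,-,+)$, $c_{12}=(\pm,\pm,\pm)$, $c_0=(0,0,0)$; $h_{11}=(\pm,\pm,+)$, $h_{12}=(\pm,\pm,-)$, $h_{13}=(0,\pm,\pm)$, $h_{14}=(+,\pm,\pm)$, $h_{15}=(-,\pm,\pm)$. Pairs for $a$. $e_{13}=(0,+)$, $e_{14}=(0,-)$, $e_{15}=(0,\pm)$, $e_{16}=(+,-)$, $e_{17}=(+,\pm)$, $e_{18}=(-,\pm)$. Classes $p=1,2,3,4$: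 $\alpha=\beta=0,+,-,\pm$ respectively. Case $\ell\in\{1,2\}$. - $p=1$: $c_k$ for $1\le k\le 12$; $c_0$ together with $a$ and $e_k$ for $13\le k\le 18$. - $p=2$: $c_k$ for $1\le k\le 9$; $(0,+,-),(-,+,-),(\pm,+,-)$ for $k=10,11,12$; $c_{10}$ with $a$ and $e_k$ for $13\le k\le 18$; $c_{11},c_{12},c_0$ for $k=19,20,21$. - $p=3$: $c_k$ for $1\le k\le 9$; the dual of $\mathcal G^{(2)}_{\ell,k}$ for $10\le k\le 21$. - $p=4$: $c_k$ for $1\le k\le 9$; $(0,\pm,\pm),(+,\pm,\pm),(-,\pm,\pm)$ for $k=10,11,12$; $c_{12}$ with $a$ and $e_k$ for $13\le k\le 18$; $c_{11},c_{10},c_0$ for $k=19,20,21$. Case $3\le\ell\le 6$ ($1\le k\le 15$): $c_k$ for $1\le k\le 6$; for $k=7,8,9,10$ the triples $c_8,c_9,c_{10},c_{11}$ if $p=1$, $c_{10},c_8,c_9,c_{11}$ if $p=2$, $c_{11},c_8,c_9,c_{10}$ if $p=3$, $c_8,c_9,c_{11},c_{10}$ if $p=4$; $h_k$ for $11\le k\le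 15$. Classes $p=5,\dots,10$: let $(\gamma,\delta)=(+,0),(-,0),(\pm,0),(+,-),(+,\pm),(-,\pm)$ respectively; $a$ is never present. Case $\ell\in\{1,2\}$: $(\alpha,\beta)=(\gamma,\delta)$ with $c_k$ for $1\le k\le 12$; $(\alpha,\beta)=(\delta,\gamma)$ with $c_{k-12}$ for $13\le k\le 21$; $(\gamma,\delta)$ with $c_0$ for $k=22$. Case $3\le\ell\le 6$: $(\gamma,\delta)$ with $c_1,\dots,c_6,c_8,c_9,c_{10},c_{11}$ for $k=1,\dots,10$; $(\delta,\gamma)$ with $c_1,\dots,c_6,c_8,c_9$ for $k=11,\dots,18$; $(\gamma,\delta)$ with $h_{13},h_{14},h_{15}$ for $k=19,20,21$; $(\delta,\gamma)$ with $h_{13},h_{14},h_{15}$ for $k=22,23,24$. **Proposition.** Let $\varphi_1(n)=2^n-1$, $\varphi_2(n)=2^n-n$, $\varphi_3(n)=2^{n-1}$ (each for $n\ge 1$), $\varphi_4(n)=2^{n-1}+1$ (for $n\ge 2$), and let $\varphi_5$ be the Fibonacci sequence, $\varphi_5(0)=\varphi_5(1)=1$, $\varphi_5(n)=\varphi_5(n-1)+\varphi_5(n-2)$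 for $n\ge2$. For every $\mathcal G\in\check{\mathfrak A}_1$ there is $i\in\{1,\dots,5\}$ such that either $\varphi_{\mathcal G}(n)=\varphi_i(n)$ for all $n$ in the stated range of $\varphi_i$, or $\varphi_{\mathcal G}(n)\ge\varphi_i(n)$ for all $n$ in that range. -/

import Mathlib

namespace OrdProfile

/-- An ordered reflexive directed graph `(V, ≤, ρ)`: a set with a linear order `le` and a reflexive
binary relation `edge`. -/
structure ReflOrdDigraph where
  V : Type
  le : V → V → Prop
  le_refl : ∀ x, le x x
  le_trans : ∀ x y z, le x y → le y z → le x z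
  le_antisymm : ∀ x y, le x y → le y x → x = y
  le_total : ∀ x y, le x y ∨ le y x
  edge : V → V → Prop
  edge_refl : ∀ x, edge x x

namespace ReflOrdDigraph

variable (G : ReflOrdDigraph)

/-- The structures induced by `G` on the finite sets `s` and `t` are isomorphic
(both the order and the edges are preserved). -/
def InducedIso (s t : Finset G.V) : Prop :=
  ∃ e : {x // x ∈ s} ≃ {x // x ∈ t}, ∀ x y : {x // x ∈ s},
    (G.le x y ↔ G.le (e x) (e y)) ∧ (G.edge x y ↔ G.edge (e x) (e y))

/-- Isomorphism of the induced structures, as an equivalence relation on the `n`-element subsets. -/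
def inducedSetoid (n : ℕ) : Setoid {s : Finset G.V // s.card = n} where
  r s t := G.InducedIso s.1 t.1
  iseqv :=
    { refl := fun s => ⟨Equiv.refl _, fun _ _ => ⟨Iff.rfl, Iff.rfl⟩⟩
      symm := by
        rintro s t ⟨e, he⟩
        refine ⟨e.symm, fun x y => ?_⟩
        have h := he (e.symm x) (e.symm y)
        simp only [Equiv.apply_symm_apply] at h
        exact ⟨h.1.symm, h.2.symm⟩
      trans := by
        rintro s t u ⟨e, he⟩ ⟨f, hf⟩
        refine ⟨e.trans f, fun x y => ?_⟩
        exact ⟨(he x y).1.trans (hf (e x) (e y)).1, (he x y).2.trans (hf (e x) (e y)).2⟩ }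

/-- The profile of `G`: the number of `n`-element induced substructures, up to isomorphism. -/
noncomputable def profile (n : ℕ) : ℕ := Nat.card (Quotient (G.inducedSetoid n))

end ReflOrdDigraph

/-! ### Codes -/

/-- A code stands for the value `d(x, y) = (ρ(x, y), ρ(y, x))` at a pair of distinct vertices. -/
abbrev Code := Bool × Bool

/-- No edge. -/
def no : Code := (false, false)
/-- Only the edge from `x` to `y`. -/
def fw : Code := (true, false)
/-- Only the edge from `y` to `x`. -/
def bw : Code := (false, true)
/-- Both edges. -/
def bo : Code := (true, true)

/-- The edges between `A = ℕ × {0}` and `B = ℕ × {1}`: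
`eq = d((n,0),(n,1))`, `lt = d((n,0),(m,1))` for `n < m`, `gt = d((n,0),(m,1))` for `n > m`. -/
structure Cross where
  eq : Code
  lt : Code
  gt : Code

/-- Reverse every edge between `A` and `B`. -/
def Cross.dual (c : Cross) : Cross := ⟨c.eq.swap, c.lt.swap, c.gt.swap⟩

/-- The data that describe an invariant structure:
`sideA = d((n,0),(m,0))` and `sideB = d((n,1),(m,1))` for `n < m`, the edges between `A` and `B`,
and, if there is an additional vertex `a`, the codes `d(a,(n,0))` and `d(a,(n,1))`. -/
structure Shape where
  sideA : Code
  sideB : Code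
  cross : Cross
  apex : Option (Code × Code)

/-! ### The underlying linear orders

The element `(n, i)` of `ℕ × {0, 1}` is written `(n, b)` with `b = false` for `i = 0` and `b = true`
for `i = 1`. -/

/-- A position in the lexicographically ordered `ℤ × ℤ`; it induces on `ℕ × {0,1}` the order
`(0,0) < (0,1) < (1,0) < (1,1) < ⋯` for `ℓ = 1`, its reverse for `ℓ = 2`, and, with `A` placed
before `B`, the order `ω + ω` for `ℓ = 3`, `ω* + ω` for `ℓ = 4`, `ω + ω*` for `ℓ = 5` and
`ω* + ω*` for `ℓ = 6`. -/
def position (ℓ : ℕ) : ℕ × Bool → ℤ ×ₗ ℤ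
  | (n, false) =>
      if ℓ = 1 then toLex (0, 2 * n)
      else if ℓ = 2 then toLex (0, -(2 * n))
      else if ℓ = 3 ∨ ℓ = 5 then toLex (0, n)
      else toLex (0, -n)
  | (n, true) =>
      if ℓ = 1 then toLex (0, 2 * n + 1)
      else if ℓ = 2 then toLex (0, -(2 * n + 1))
      else if ℓ = 3 ∨ ℓ = 4 then toLex (1, n)
      else toLex (1, -n)

/-- The same with the vertex `a = none` added, as the least element if `ℓ = 1` and as the greatest
element otherwise (it is used for `ℓ = 1, 2` only). -/
def positionApex (ℓ : ℕ) : Option (ℕ × Bool) → ℤ ×ₗ ℤ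
  | none => if ℓ = 1 then toLex (-1, 0) else toLex (2, 0)
  | some x => position ℓ x

theorem position_injective (ℓ : ℕ) : Function.Injective (position ℓ) := by
  rintro ⟨n, _ | _⟩ ⟨m, _ | _⟩ h <;> simp only [position] at h <;> split_ifs at h <;>
    simp only [EmbeddingLike.apply_eq_iff_eq, Prod.mk.injEq] at h <;>
    first
      | (exfalso; omega)
      | (have h' : n = m := by omega
         rw [h'])

theorem positionApex_injective (ℓ : ℕ) : Function.Injective (positionApex ℓ) := by
  have key : ∀ x : ℕ × Bool, (ofLex (position ℓ x)).1 = 0 ∨ (ofLex (position ℓ x)).1 = 1 := by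
    rintro ⟨n, _ | _⟩ <;> simp only [position] <;> split_ifs <;> simp
  rintro (_ | x) (_ | y) h
  · rfl
  · exfalso
    have hk := key y
    simp only [positionApex] at h
    rw [← h] at hk
    split_ifs at hk <;> simp at hk
  · exfalso
    have hk := key x
    simp only [positionApex] at h
    rw [h] at hk
    split_ifs at hk <;> simp at hk
  · exact congrArg some (position_injective ℓ h)

/-! ### The structures -/

/-- `edgeBool c n m`: is `(x_n, x_m)` an edge, if all loops are present and
`d(x_n, x_m) = c` for `n < m`. -/
def edgeBool (c : Code) (n m : ℕ) : Bool :=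
  if n < m then c.1 else if m < n then c.2 else true

/-- The edge relation on `ℕ × {0,1}` described by a shape. -/
def Shape.edge (S : Shape) : ℕ × Bool → ℕ × Bool → Bool
  | (n, false), (m, false) => edgeBool S.sideA n m
  | (n, true), (m, true) => edgeBool S.sideB n m
  | (n, false), (m, true) =>
      if n = m then S.cross.eq.1 else if n < m then S.cross.lt.1 else S.cross.gt.1
  | (n, true), (m, false) =>
      if m = n then S.cross.eq.2 else if m < n then S.cross.lt.2 else S.cross.gt.2

/-- The edge relation on `{a} ∪ ℕ × {0,1}`; the codes `c.1`, `c.2` are `d(a,(n,0))`, `d(a,(n,1))`. -/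
def Shape.edgeApex (S : Shape) (c : Code × Code) :
    Option (ℕ × Bool) → Option (ℕ × Bool) → Bool
  | none, none => true
  | none, some (_, false) => c.1.1
  | none, some (_, true) => c.2.1
  | some (_, false), none => c.1.2
  | some (_, true), none => c.2.2
  | some x, some y => S.edge x y

/-- The ordered reflexive directed graph with a given linear order and a given shape, with vertex set
`ℕ × {0,1}`, or `{a} ∪ ℕ × {0,1}` if the shape has a vertex `a`. -/
def Shape.toDigraph (ℓ : ℕ) (S : Shape) : ReflOrdDigraph :=
  match S.apex with
  | none =>
    { V := ℕ × Bool
      le := fun x y => position ℓ x ≤ position ℓ y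
      le_refl := fun _ => le_rfl
      le_trans := fun _ _ _ => le_trans
      le_antisymm := fun _ _ h h' => position_injective ℓ (le_antisymm h h')
      le_total := fun _ _ => le_total _ _
      edge := fun x y => S.edge x y = true
      edge_refl := by rintro ⟨n, _ | _⟩ <;> simp [Shape.edge, edgeBool] }
  | some c =>
    { V := Option (ℕ × Bool)
      le := fun x y => positionApex ℓ x ≤ positionApex ℓ y
      le_refl := fun _ => le_rfl
      le_trans := fun _ _ _ => le_trans
      le_antisymm := fun _ _ h h' => positionApex_injective ℓ (le_antisymm h h')
      le_total := fun _ _ => le_total _ _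
      edge := fun x y => S.edgeApex c x y = true
      edge_refl := by rintro (_ | ⟨n, _ | _⟩) <;> simp [Shape.edgeApex, Shape.edge, edgeBool] }

/-! ### The list of 1242 structures -/

/-- No edge between `A` and `B`. -/
def emptyCross : Cross := ⟨no, no, no⟩

/-- The edges between `A` and `B` of the graphs `G_{ℓ,k}^{(1)}`, `ℓ ∈ {1,2}`, `1 ≤ k ≤ 12`. -/
def cross1 : ℕ → Cross
  | 1 => ⟨fw, no, no⟩
  | 2 => ⟨bw, no, no⟩
  | 3 => ⟨bo, no, no⟩
  | 4 => ⟨fw, fw, no⟩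
  | 5 => ⟨bw, bw, no⟩
  | 6 => ⟨bo, bo, no⟩
  | 7 => ⟨fw, fw, fw⟩
  | 8 => ⟨fw, fw, bo⟩
  | 9 => ⟨bw, bw, bo⟩
  | 10 => ⟨fw, fw, bw⟩
  | 11 => ⟨bw, bw, fw⟩
  | 12 => ⟨bo, bo, bo⟩
  | _ => emptyCross

/-- The edges between `A` and `B` of the graphs `G_{ℓ,k}^{(p)}`, `3 ≤ ℓ ≤ 6`, `1 ≤ p ≤ 4`,
`11 ≤ k ≤ 15`. -/
def cross2 : ℕ → Cross
  | 11 => ⟨bo, bo, fw⟩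
  | 12 => ⟨bo, bo, bw⟩
  | 13 => ⟨no, bo, bo⟩
  | 14 => ⟨fw, bo, bo⟩
  | 15 => ⟨bw, bo, bo⟩
  | _ => emptyCross

/-- The codes `d(a,(n,0))` and `d(a,(n,1))` in the graphs `G_{ℓ,k}^{(1)}`, `13 ≤ k ≤ 18`. -/
def apexCodes : ℕ → Code × Code
  | 13 => (no, fw)
  | 14 => (no, bw)
  | 15 => (no, bo)
  | 16 => (fw, bw)
  | 17 => (fw, bo)
  | 18 => (bw, bo)
  | _ => (no, no)

/-- The common code of `A` and `B` in the classes `p = 1, 2, 3, 4`: antichain, chain `ω`,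
chain `ω*`, clique. -/
def side : ℕ → Code
  | 1 => no
  | 2 => fw
  | 3 => bw
  | _ => bo

/-- For the classes `5 ≤ p ≤ 10`: the code that replaces the chain of the class `5` and the code that
replaces the antichain of the class `5`. -/
def sides : ℕ → Code × Code
  | 5 => (fw, no)
  | 6 => (bw, no)
  | 7 => (bo, no)
  | 8 => (fw, bw)
  | 9 => (fw, bo)
  | _ => (bw, bo)

/-- Class `p = 1`, `ℓ ∈ {1,2}`, `1 ≤ k ≤ 18`. -/
def shapeLow1 (k : ℕ) : Shape :=
  if k ≤ 12 then ⟨no, no, cross1 k, none⟩ else ⟨no, no, emptyCross, some (apexCodes k)⟩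

/-- Class `p = 2`, `ℓ ∈ {1,2}`, `1 ≤ k ≤ 21`. -/
def shapeLow2 (k : ℕ) : Shape :=
  if k ≤ 9 then ⟨fw, fw, cross1 k, none⟩
  else if k = 10 then ⟨fw, fw, ⟨no, fw, bw⟩, none⟩
  else if k = 11 then ⟨fw, fw, ⟨bw, fw, bw⟩, none⟩
  else if k = 12 then ⟨fw, fw, ⟨bo, fw, bw⟩, none⟩
  else if k ≤ 18 then ⟨fw, fw, cross1 10, some (apexCodes k)⟩
  else if k = 19 then ⟨fw, fw, cross1 11, none⟩
  else if k = 20 then ⟨fw, fw, cross1 12, none⟩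
  else ⟨fw, fw, emptyCross, none⟩

/-- Class `p = 3`, `ℓ ∈ {1,2}`, `1 ≤ k ≤ 21`; for `k ≥ 10` these are the duals of the graphs of the
class `2`. -/
def shapeLow3 (k : ℕ) : Shape :=
  if k ≤ 9 then ⟨bw, bw, cross1 k, none⟩
  else ⟨bw, bw, (shapeLow2 k).cross.dual, (shapeLow2 k).apex.map fun c => (c.1.swap, c.2.swap)⟩

/-- Class `p = 4`, `ℓ ∈ {1,2}`, `1 ≤ k ≤ 21`. -/
def shapeLow4 (k : ℕ) : Shape :=
  if k ≤ 9 then ⟨bo, bo, cross1 k, none⟩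
  else if k = 10 then ⟨bo, bo, ⟨no, bo, bo⟩, none⟩
  else if k = 11 then ⟨bo, bo, ⟨fw, bo, bo⟩, none⟩
  else if k = 12 then ⟨bo, bo, ⟨bw, bo, bo⟩, none⟩
  else if k ≤ 18 then ⟨bo, bo, ⟨bo, bo, bo⟩, some (apexCodes k)⟩
  else if k = 19 then ⟨bo, bo, cross1 11, none⟩
  else if k = 20 then ⟨bo, bo, (cross1 11).dual, none⟩
  else ⟨bo, bo, emptyCross, none⟩

/-- Classes `5 ≤ p ≤ 10`, `ℓ ∈ {1,2}`, `1 ≤ k ≤ 22`. -/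
def shapeLow5 (p k : ℕ) : Shape :=
  if k ≤ 12 then ⟨(sides p).1, (sides p).2, cross1 k, none⟩
  else if k ≤ 21 then ⟨(sides p).2, (sides p).1, cross1 (k - 12), none⟩
  else ⟨(sides p).1, (sides p).2, emptyCross, none⟩

/-- `ℓ ∈ {1,2}`. -/
def shapeLow (p k : ℕ) : Shape :=
  if p = 1 then shapeLow1 k
  else if p = 2 then shapeLow2 k
  else if p = 3 then shapeLow3 k
  else if p = 4 then shapeLow4 k
  else shapeLow5 p k

/-- The edges between `A` and `B` for `1 ≤ p ≤ 4`, `3 ≤ ℓ ≤ 6`, `7 ≤ k ≤ 10`. -/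
def cross3 : ℕ → ℕ → Cross
  | 2, 7 => cross1 10
  | 2, 8 => cross1 8
  | 2, 9 => cross1 9
  | 2, _ => cross1 11
  | 3, 7 => (cross1 10).dual
  | 3, 8 => cross1 8
  | 3, 9 => cross1 9
  | 3, _ => (cross1 11).dual
  | 4, 9 => cross1 11
  | 4, 10 => (cross1 11).dual
  | _, k => cross1 (k + 1)

/-- `3 ≤ ℓ ≤ 6`, with `1 ≤ k ≤ 15` for `p ≤ 4` and `1 ≤ k ≤ 24` for `p ≥ 5`. -/
def shapeHigh (p k : ℕ) : Shape :=
  if p ≤ 4 then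
    if k ≤ 6 then ⟨side p, side p, cross1 k, none⟩
    else if k ≤ 10 then ⟨side p, side p, cross3 p k, none⟩
    else ⟨side p, side p, cross2 k, none⟩
  else
    if k ≤ 6 then shapeLow5 p k
    else if k ≤ 10 then shapeLow5 p (k + 1)
    else if k ≤ 16 then shapeLow5 p (k + 2)
    else if k ≤ 18 then shapeLow5 p (k + 3)
    else if k ≤ 21 then ⟨(sides p).1, (sides p).2, cross2 (k - 6), none⟩
    else ⟨(sides p).2, (sides p).1, cross2 (k - 9), none⟩

/-- The structure `𝒢_{ℓ,k}^{(p)}`. -/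
def member (p ℓ k : ℕ) : ReflOrdDigraph :=
  (if ℓ ≤ 2 then shapeLow p k else shapeHigh p k).toDigraph ℓ

/-- The number of structures with parameters `p` and `ℓ`. -/
def count (p ℓ : ℕ) : ℕ :=
  if ℓ ≤ 2 then (if p = 1 then 18 else if p ≤ 4 then 21 else 22)
  else (if p ≤ 4 then 15 else 24)

/-- The triples `(p, ℓ, k)` of parameters. -/
def indices : Finset (ℕ × ℕ × ℕ) :=
  (Finset.Icc 1 10).biUnion fun p => (Finset.Icc 1 6).biUnion fun ℓ =>
    (Finset.Icc 1 (count p ℓ)).image fun k => (p, ℓ, k)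

theorem card_indices : indices.card = 1242 := by
  have h : ∀ (p ℓ : ℕ) , ((Finset.Icc 1 (count p ℓ)).image fun k => (p, ℓ, k)).card = count p ℓ := by
    intro p ℓ
    rw [Finset.card_image_of_injective _ (by intro a b hab; simpa using hab)]
    simp
  rw [indices, Finset.card_biUnion]
  · have : ∀ p ∈ Finset.Icc 1 10, ((Finset.Icc 1 6).biUnion fun ℓ =>
        (Finset.Icc 1 (count p ℓ)).image fun k => (p, ℓ, k)).card
        = ∑ ℓ ∈ Finset.Icc 1 6, count p ℓ := by
      intro p _
      rw [Finset.card_biUnion]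
      · exact Finset.sum_congr rfl fun ℓ _ => h p ℓ
      · intro a _ b _ hab
        rw [Function.onFun, Finset.disjoint_left]
        intro x hx hy
        simp only [Finset.mem_image] at hx hy
        obtain ⟨_, _, rfl⟩ := hx
        obtain ⟨_, _, h2⟩ := hy
        simp only [Prod.mk.injEq] at h2
        exact hab h2.2.1.symm
    rw [Finset.sum_congr rfl this]
    decide
  · intro a _ b _ hab
    rw [Function.onFun, Finset.disjoint_left]
    intro x hx hy
    simp only [Finset.mem_biUnion, Finset.mem_image] at hx hy
    obtain ⟨_, _, _, _, rfl⟩ := hx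
    obtain ⟨_, _, _, _, h2⟩ := hy
    simp only [Prod.mk.injEq] at h2
    exact hab h2.1.symm

/-- The set of the 1242 ordered reflexive directed graphs `𝒢_{ℓ,k}^{(p)}`. -/
def basis : Set ReflOrdDigraph :=
  {G | ∃ p ℓ k : ℕ, (p, ℓ, k) ∈ indices ∧ G = member p ℓ k}

/-- The five comparison functions `2^n - 1`, `2^n - n`, `2^(n-1)`, `2^(n-1) + 1` and the Fibonacci
sequence `1, 1, 2, 3, 5, …`, each with the least `n` at which it is considered. -/
def comparison : Set ((ℕ → ℕ) × ℕ) :=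
  {(fun n => 2 ^ n - 1, 1), (fun n => 2 ^ n - n, 1), (fun n => 2 ^ (n - 1), 1),
    (fun n => 2 ^ (n - 1) + 1, 2), (fun n => Nat.fib (n + 1), 0)}

end OrdProfile

/-!
The Fibonacci sequence `Nat.fib (n + 1)` is a lower bound for the profiles of all structures of the
list, so it serves as comparison function for all of them (`fib_le_profile_member`).

What the structures have in common is that they are not degenerate (`Shape.varied`, checked for the
whole list by evaluation): either the vertex `a` distinguishes `A` from `B`, or the codes that occur
are not all equal, where only the codes between `A` and `B` count if `A` precedes `B`. A
non-degenerate structure has, for each `n`, one of the following two families of pairwise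
non-isomorphic `n`-element substructures.

* *Words*: one vertex `(i, w i)` on each of the levels `i < n`, with the letter at one place `z`
  prescribed (or with the vertex `a` added to a word of length `n - 1`). There are `2 ^ (n - 1)` of
  them, and `2 ^ (n - 1) ≥ Nat.fib (n + 1)` for `n ≥ 1`. In the interleaved orders an isomorphism has
  to preserve the levels, and the codes at the vertex of the level `z`, or at `a`, give the letters.
  If `A` precedes `B`, the codes from `A` to `B` on different levels have to tell the lower of two
  levels; then it is enough to recognize the letters (`letter_of_high`).
* *Matchings*: the vertices of `A` on the levels `i < k`, and the vertices of `B` on the levels in a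
  set `T ⊆ {0, …, k - 1}`, where `k + |T| = n`. There are `∑ choose k (n - k) = Nat.fib (n + 1)` of
  them. They are distinguished if an isomorphism preserves the letters and the pairs of vertices on
  the same level (`fib_le_profile`), as it does when the codes of vertices on different levels do not
  suffice for the first family. If `A` precedes `B`, this argument needs `n ≠ 2`; for `n = 2` a matched
  and an unmatched pair are used instead.
-/

namespace OrdProfile

/-! ### Lower bounds for profiles -/

namespace ReflOrdDigraph

variable (G : ReflOrdDigraph)

/-- The set `G.V` with the linear order `G.le`. -/
noncomputable abbrev linearOrder : LinearOrder G.V where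
  le := G.le
  le_refl := G.le_refl
  le_trans := G.le_trans
  le_antisymm := G.le_antisymm
  le_total := G.le_total
  toDecidableLE := Classical.decRel _

/-- An `n`-element induced substructure is determined up to isomorphism by its edge matrix with
respect to the increasing enumeration, so there are finitely many isomorphism types. -/
theorem finite_quotient (n : ℕ) : Finite (Quotient (G.inducedSetoid n)) := by
  let _ := G.linearOrder
  let M : {s : Finset G.V // s.card = n} → Fin n → Fin n → Prop := fun s i j =>
    G.edge (s.1.orderIsoOfFin s.2 i) (s.1.orderIsoOfFin s.2 j)
  suffices key : ∀ s t, M s = M t → G.InducedIso s.1 t.1 by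
    refine Finite.of_injective (fun q : Quotient (G.inducedSetoid n) => M q.out) fun q r h => ?_
    rw [← Quotient.out_eq q, ← Quotient.out_eq r]
    exact Quotient.sound (key _ _ h)
  intro s t h
  refine ⟨((s.1.orderIsoOfFin s.2).symm.trans (t.1.orderIsoOfFin t.2)).toEquiv, fun x y => ?_⟩
  constructor
  · exact (((s.1.orderIsoOfFin s.2).symm.trans (t.1.orderIsoOfFin t.2)).le_iff_le
      (x := x) (y := y)).symm
  · have := congrFun (congrFun h ((s.1.orderIsoOfFin s.2).symm x)) ((s.1.orderIsoOfFin s.2).symm y)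
    simp only [M, OrderIso.apply_symm_apply, eq_iff_iff] at this
    exact this

/-- Pairwise non-isomorphic induced substructures on `n`-element sets bound the profile at `n` from
below. -/
theorem card_le_profile {ι : Type*} (n : ℕ) (I : Finset ι) (S : ι → Finset G.V)
    (hS : ∀ i ∈ I, (S i).card = n)
    (h : ∀ i ∈ I, ∀ j ∈ I, G.InducedIso (S i) (S j) → i = j) : I.card ≤ G.profile n := by
  have := G.finite_quotient n
  rw [profile, ← Nat.card_eq_finsetCard I]
  refine Nat.card_le_card_of_injective
    (fun i : I => (Quotient.mk (G.inducedSetoid n) ⟨S i, hS i i.2⟩)) ?_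
  intro i j hij
  exact Subtype.ext (h i i.2 j j.2 (Quotient.exact hij))

/-- The bound for families of sets that are enumerated by `Fin n`. -/
theorem card_le_profile_of_enum {ι : Type*} [Fintype ι] (n : ℕ) (f : ι → Fin n → G.V)
    (hf : ∀ i, Function.Injective (f i))
    (h : ∀ i j, ∀ σ : Equiv.Perm (Fin n),
      (∀ x y, G.le (f i x) (f i y) ↔ G.le (f j (σ x)) (f j (σ y))) →
      (∀ x y, G.edge (f i x) (f i y) ↔ G.edge (f j (σ x)) (f j (σ y))) → i = j) :
    Fintype.card ι ≤ G.profile n := by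
  refine G.card_le_profile n Finset.univ (fun i => Finset.univ.map ⟨f i, hf i⟩) (by simp) ?_
  rintro i - j - ⟨e, he⟩
  have hm : ∀ i x, f i x ∈ Finset.univ.map ⟨f i, hf i⟩ := by simp
  have hs : ∀ x, ∃ y, f j y = e ⟨f i x, hm i x⟩ := fun x => by
    have := (e ⟨f i x, hm i x⟩).2
    rw [Finset.mem_map] at this
    simpa using this
  choose s hs using hs
  have hinj : Function.Injective s := by
    intro x y hxy
    have h1 : (e ⟨f i x, hm i x⟩ : G.V) = e ⟨f i y, hm i y⟩ := by rw [← hs, ← hs, hxy]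
    exact hf i (congrArg Subtype.val (e.injective (Subtype.ext h1)))
  refine h i j (Equiv.ofBijective s (Finite.injective_iff_bijective.1 hinj)) ?_ ?_ <;> intro x y
  · simpa [hs] using (he ⟨f i x, hm i x⟩ ⟨f i y, hm i y⟩).1
  · simpa [hs] using (he ⟨f i x, hm i x⟩ ⟨f i y, hm i y⟩).2

/-- An isomorphism of induced substructures as a map of the ambient vertex set. -/
theorem InducedIso.exists_bijOn {G : ReflOrdDigraph} {s t : Finset G.V} (h : G.InducedIso s t) :
    ∃ g : G.V → G.V, Set.BijOn g s t ∧ ∀ x ∈ s, ∀ y ∈ s,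
      (G.le x y ↔ G.le (g x) (g y)) ∧ (G.edge x y ↔ G.edge (g x) (g y)) := by
  classical
  obtain ⟨e, he⟩ := h
  refine ⟨fun x => if hx : x ∈ s then e ⟨x, hx⟩ else x, ⟨?_, ?_, ?_⟩, ?_⟩
  · intro x hx
    have hx' : x ∈ s := hx
    simp [hx']
  · intro x hx y hy hxy
    have hx' : x ∈ s := hx
    have hy' : y ∈ s := hy
    simp only [hx', hy', dite_true] at hxy
    exact congrArg Subtype.val (e.injective (Subtype.ext hxy))
  · intro y hy
    exact ⟨e.symm ⟨y, hy⟩, (e.symm ⟨y, hy⟩).2, by simp⟩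
  · intro x hx y hy
    simpa [hx, hy] using he ⟨x, hx⟩ ⟨y, hy⟩

end ReflOrdDigraph

theorem perm_eq_one_of_strictMono {n : ℕ} (σ : Equiv.Perm (Fin n)) (h : StrictMono σ) : σ = 1 := by
  ext1 x
  exact congrFun ((StrictMono.range_inj h strictMono_id).1 (by simp [σ.surjective.range_eq])) x

theorem fib_le_two_pow (m : ℕ) : Nat.fib (m + 2) ≤ 2 ^ m := by
  induction m using Nat.strong_induction_on with
  | _ m ih =>
    match m with
    | 0 => simp
    | 1 => simp [Nat.fib_add_two]
    | m + 2 =>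
      have h1 := ih m (by omega)
      have h2 := ih (m + 1) (by omega)
      have h3 : Nat.fib (m + 2 + 2) = Nat.fib (m + 2) + Nat.fib (m + 1 + 2) := Nat.fib_add_two
      rw [h3]
      have h4 : 2 ^ (m + 2) = 2 * 2 ^ (m + 1) := by ring
      have h5 : 2 ^ (m + 1) = 2 * 2 ^ m := by ring
      omega

/-! ### Codes and orders -/

/-- The code `d(x, y)` of a pair of vertices of `ℕ × {0,1}`. -/
def Shape.code (S : Shape) (x y : ℕ × Bool) : Code := (S.edge x y, S.edge y x)

section Code

variable (S : Shape) {n m : ℕ}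

theorem Shape.code_swap (x y : ℕ × Bool) : (S.code x y).swap = S.code y x := rfl

theorem Shape.code_false_false (h : n < m) : S.code (n, false) (m, false) = S.sideA := by
  simp [Shape.code, Shape.edge, edgeBool, h, h.not_gt]

theorem Shape.code_true_true (h : n < m) : S.code (n, true) (m, true) = S.sideB := by
  simp [Shape.code, Shape.edge, edgeBool, h, h.not_gt]

theorem Shape.code_eq : S.code (n, false) (n, true) = S.cross.eq := by
  simp [Shape.code, Shape.edge]

theorem Shape.code_lt (h : n < m) : S.code (n, false) (m, true) = S.cross.lt := by
  simp [Shape.code, Shape.edge, h, h.ne]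

theorem Shape.code_gt (h : m < n) : S.code (n, false) (m, true) = S.cross.gt := by
  simp [Shape.code, Shape.edge, h.not_gt, h.ne']

end Code

theorem position_one_le_iff (x y : ℕ × Bool) :
    position 1 x ≤ position 1 y ↔ 2 * x.1 + x.2.toNat ≤ 2 * y.1 + y.2.toNat := by
  obtain ⟨n, _ | _⟩ := x <;> obtain ⟨m, _ | _⟩ := y <;>
    simp [position, Prod.Lex.toLex_le_toLex] <;> omega

theorem position_two_le_iff (x y : ℕ × Bool) :
    position 2 x ≤ position 2 y ↔ 2 * y.1 + y.2.toNat ≤ 2 * x.1 + x.2.toNat := by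
  obtain ⟨n, _ | _⟩ := x <;> obtain ⟨m, _ | _⟩ := y <;>
    simp [position, Prod.Lex.toLex_le_toLex] <;> omega

theorem position_same (ℓ : ℕ) (b : Bool) :
    (∀ n m, position ℓ (n, b) ≤ position ℓ (m, b) ↔ n ≤ m) ∨
      (∀ n m, position ℓ (n, b) ≤ position ℓ (m, b) ↔ m ≤ n) := by
  cases b <;> simp only [position] <;> split_ifs <;>
    simp only [Prod.Lex.toLex_le_toLex, lt_self_iff_false, true_and, false_or] <;>
    first
      | (left; intro n m; omega)
      | (right; intro n m; omega)

theorem position_false_le_true {ℓ : ℕ} (hℓ : 3 ≤ ℓ) (n m : ℕ) :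
    position ℓ (n, false) ≤ position ℓ (m, true) := by
  have h1 : ℓ ≠ 1 := by omega
  have h2 : ℓ ≠ 2 := by omega
  simp only [position, h1, h2, if_false]
  split_ifs <;> simp [Prod.Lex.toLex_le_toLex]

theorem position_not_true_le_false {ℓ : ℕ} (hℓ : 3 ≤ ℓ) (n m : ℕ) :
    ¬ position ℓ (n, true) ≤ position ℓ (m, false) := by
  have h1 : ℓ ≠ 1 := by omega
  have h2 : ℓ ≠ 2 := by omega
  simp only [position, h1, h2, if_false]
  split_ifs <;> simp [Prod.Lex.toLex_le_toLex]

/-- The structure on `ℕ × {0,1}` of a shape, whose vertex `a`, if there is one, is ignored. -/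
def Shape.plain (ℓ : ℕ) (S : Shape) : ReflOrdDigraph where
  V := ℕ × Bool
  le := fun x y => position ℓ x ≤ position ℓ y
  le_refl := fun _ => le_rfl
  le_trans := fun _ _ _ => le_trans
  le_antisymm := fun _ _ h h' => position_injective ℓ (le_antisymm h h')
  le_total := fun _ _ => le_total _ _
  edge := fun x y => S.edge x y = true
  edge_refl := by rintro ⟨n, _ | _⟩ <;> simp [Shape.edge, edgeBool]

theorem Shape.toDigraph_eq_plain (ℓ : ℕ) {S : Shape} (h : S.apex = none) :
    S.toDigraph ℓ = S.plain ℓ := by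
  obtain ⟨α, β, X, e⟩ := S
  subst h
  rfl

/-! ### Words: one vertex on each level -/

/-- A word `w` in the letters `A`, `B` (`false`, `true`) stands for the structure induced on the
vertices `(i, w i)`; the permutation `σ` of the levels is an isomorphism from `w` to `w'`. -/
structure WordIso (ℓ : ℕ) (S : Shape) {n : ℕ} (w w' : Fin n → Bool) (σ : Equiv.Perm (Fin n)) :
    Prop where
  le_iff : ∀ x y : Fin n, position ℓ (x, w x) ≤ position ℓ (y, w y) ↔
    position ℓ (σ x, w' (σ x)) ≤ position ℓ (σ y, w' (σ y))
  code_eq : ∀ x y : Fin n,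
    S.code (x, w x) (y, w y) = S.code (σ x, w' (σ x)) (σ y, w' (σ y))

theorem WordIso.symm {ℓ : ℕ} {S : Shape} {n : ℕ} {w w' : Fin n → Bool} {σ : Equiv.Perm (Fin n)}
    (h : WordIso ℓ S w w' σ) : WordIso ℓ S w' w σ⁻¹ where
  le_iff x y := by simpa using (h.le_iff (σ⁻¹ x) (σ⁻¹ y)).symm
  code_eq x y := by simpa using (h.code_eq (σ⁻¹ x) (σ⁻¹ y)).symm

/-- If the words with a prescribed letter at the place `z` give pairwise non-isomorphic
structures, the profile is at least `2 ^ m`. -/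
theorem two_pow_le_profile (ℓ : ℕ) (S : Shape) {m : ℕ} (z : Fin (m + 1)) (b : Bool)
    (h : ∀ w w' : Fin (m + 1) → Bool, w z = b → w' z = b → ∀ σ : Equiv.Perm (Fin (m + 1)),
      WordIso ℓ S w w' σ → w = w') :
    2 ^ m ≤ (S.plain ℓ).profile (m + 1) := by
  have := (S.plain ℓ).card_le_profile_of_enum (ι := Fin m → Bool) (m + 1)
    (fun w i => ((i : ℕ), z.insertNth (α := fun _ => Bool) b w i)) ?_ ?_
  · simpa using this
  · intro w i j hij
    exact Fin.ext (congrArg Prod.fst hij)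
  · intro w w' σ h1 h2
    refine Fin.insertNth_right_injective (α := fun _ => Bool) (p := z) b
      (h _ _ (by simp) (by simp) σ ⟨h1, fun x y => ?_⟩)
    have e1 := Bool.eq_iff_iff.2 (h2 x y)
    have e2 := Bool.eq_iff_iff.2 (h2 y x)
    exact Prod.ext e1 e2

/-- In the interleaved orders the place of a vertex of a word is its level, so an isomorphism of words
is the identity. -/
theorem perm_eq_one_of_low {ℓ : ℕ} (hℓ : ℓ = 1 ∨ ℓ = 2) {n : ℕ} {w w' : Fin n → Bool}
    {S : Shape} {σ : Equiv.Perm (Fin n)} (h : WordIso ℓ S w w' σ) : σ = 1 := by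
  refine perm_eq_one_of_strictMono σ fun x y hxy => ?_
  by_contra hc
  have hne : σ x ≠ σ y := fun e => hxy.ne (σ.injective e)
  have hne' : (σ x : ℕ) ≠ σ y := fun e => hne (Fin.ext e)
  have b1 := Bool.toNat_le (w x)
  have b2 := Bool.toNat_le (w y)
  have b3 := Bool.toNat_le (w' (σ x))
  have b4 := Bool.toNat_le (w' (σ y))
  rw [Fin.lt_def] at hxy hc
  rcases hℓ with rfl | rfl
  · have := h.le_iff x y
    simp only [position_one_le_iff] at this
    omega
  · have := h.le_iff x y
    simp only [position_two_le_iff] at this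
    omega

/-- If the letters of a word can be read off from the codes at the vertex of the level `z`, all words
with a prescribed letter at `z` are distinguished. -/
theorem two_pow_le_profile_of_low {ℓ : ℕ} (hℓ : ℓ = 1 ∨ ℓ = 2) (S : Shape) {m : ℕ}
    (z : Fin (m + 1)) (b : Bool) (h : ∀ i : Fin (m + 1), i ≠ z →
      S.code (z, b) (i, false) ≠ S.code (z, b) (i, true)) :
    2 ^ m ≤ (S.plain ℓ).profile (m + 1) := by
  refine two_pow_le_profile ℓ S z b fun w w' hw hw' σ hσ => ?_
  obtain rfl := perm_eq_one_of_low hℓ hσ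
  funext i
  by_cases hi : i = z
  · rw [hi, hw, hw']
  · have h3 := hσ.code_eq z i
    have h4 := h i hi
    simp only [Equiv.Perm.one_apply, hw, hw'] at h3
    cases h5 : w i <;> cases h6 : w' i <;> rw [h5, h6] at h3
    · exact absurd h3 h4
    · exact absurd h3.symm h4

/-- Let `A` precede `B` and let `z` be a level such that every vertex of `B` on another level has the
same code `c` from `(z, 0)`, different from the code `a` of the increasing pairs in `A`. An
isomorphism of words with letter `A` at `z` preserves the letters: if it moved `y ∈ B` into `A`, it
would also move `(z, 0)` into `A`, since `(z, 0) < y`, and turn the code `c` into `a`. -/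
theorem letter_of_high {ℓ : ℕ} (hℓ : 3 ≤ ℓ) {S : Shape} {n : ℕ} {z : Fin n} {a c : Code}
    (hc : ∀ y : Fin n, y ≠ z → S.code (z, false) (y, true) = c)
    (ha : ∀ i j : ℕ, i ≠ j → position ℓ (i, false) ≤ position ℓ (j, false) →
      S.code (i, false) (j, false) = a)
    (hac : c ≠ a) {w w' : Fin n → Bool} (hw : w z = false) {σ : Equiv.Perm (Fin n)}
    (h : WordIso ℓ S w w' σ)
    (y : Fin n) (hy : w y = true) : w' (σ y) = true := by
  by_contra hy'
  rw [Bool.not_eq_true] at hy'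
  have hyz : y ≠ z := by rintro rfl; simp [hw] at hy
  have hle : position ℓ (σ z, w' (σ z)) ≤ position ℓ (σ y, w' (σ y)) := by
    rw [← h.le_iff, hw, hy]
    exact position_false_le_true hℓ _ _
  have hz' : w' (σ z) = false := by
    rw [← Bool.not_eq_true]
    intro hz'
    rw [hz', hy'] at hle
    exact position_not_true_le_false hℓ _ _ hle
  have h3 := h.code_eq z y
  rw [hw, hy, hz', hy', hc y hyz, ha] at h3
  · exact hac h3
  · exact fun e => hyz (σ.injective (Fin.ext e)).symm
  · rwa [hz', hy'] at hle

/-- An isomorphism of words that preserves the letters preserves the levels if the codes of `A` and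
`B` tell which of two levels is the lower one. -/
theorem perm_eq_one_of_letter {ℓ : ℕ} {S : Shape} (hS : S.cross.lt ≠ S.cross.gt) {n : ℕ}
    {w w' : Fin n → Bool} {σ : Equiv.Perm (Fin n)}
    (h : WordIso ℓ S w w' σ)
    (hl : ∀ x, w' (σ x) = w x) : σ = 1 := by
  have cross : ∀ x y, w x = false → w y = true → (x < y ↔ σ x < σ y) := by
    intro x y hx hy
    have h3 := h.code_eq x y
    have hxy : x ≠ y := by rintro rfl; simp [hx] at hy
    have hσ : σ x ≠ σ y := fun e => hxy (σ.injective e)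
    rw [hl, hl, hx, hy] at h3
    rcases hxy.lt_or_gt with h | h <;> rcases hσ.lt_or_gt with h' | h'
    · exact iff_of_true h h'
    · rw [S.code_lt h, S.code_gt h'] at h3
      exact absurd h3 hS
    · rw [S.code_gt h, S.code_lt h'] at h3
      exact absurd h3.symm hS
    · exact iff_of_false h.not_gt h'.not_gt
  refine perm_eq_one_of_strictMono σ fun x y hxy => ?_
  have hσ : σ x ≠ σ y := fun e => hxy.ne (σ.injective e)
  by_cases hb : w x = w y
  · have h3 := h.le_iff x y
    have h4 := h.le_iff y x
    rw [hl, hl, ← hb] at h3 h4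
    refine lt_of_le_of_ne ?_ hσ
    rcases position_same ℓ (w x) with h | h <;> rw [h, h] at h3 h4
    · exact Fin.le_def.2 (h3.1 hxy.le)
    · exact Fin.le_def.2 (h4.1 hxy.le)
  · cases hx : w x <;> cases hy : w y <;> simp only [hx, hy, not_true_eq_false] at hb
    · exact (cross x y hx hy).1 hxy
    · exact lt_of_le_of_ne (not_lt.1 fun h => hxy.not_gt ((cross y x hy hx).2 h)) hσ

/-- The increasing pairs of vertices of `A` all have the same code. -/
theorem exists_code_sideA (ℓ : ℕ) (S : Shape) : ∃ a, ∀ i j : ℕ, i ≠ j →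
    position ℓ (i, false) ≤ position ℓ (j, false) → S.code (i, false) (j, false) = a := by
  rcases position_same ℓ false with h | h
  · refine ⟨S.sideA, fun i j hij hle => S.code_false_false ?_⟩
    exact lt_of_le_of_ne ((h _ _).1 hle) hij
  · refine ⟨S.sideA.swap, fun i j hij hle => ?_⟩
    rw [← S.code_swap, S.code_false_false (lt_of_le_of_ne ((h _ _).1 hle) hij.symm)]

/-- If `A` precedes `B` and the codes from `A` to `B` depend on the order of the levels, suitable words
are distinguished. -/
theorem two_pow_le_profile_of_high {ℓ : ℕ} (hℓ : 3 ≤ ℓ) (S : Shape)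
    (hS : S.cross.lt ≠ S.cross.gt) (m : ℕ) : 2 ^ m ≤ (S.plain ℓ).profile (m + 1) := by
  obtain ⟨a, ha⟩ := exists_code_sideA ℓ S
  -- One of the two different codes `lt`, `gt` is not `a`; it is the code from a vertex of `A` on the
  -- lowest level (for `lt`) or on the highest level (for `gt`) to all vertices of `B`.
  obtain ⟨z, c, hc, hac⟩ : ∃ (z : Fin (m + 1)) (c : Code),
      (∀ y : Fin (m + 1), y ≠ z → S.code (z, false) (y, true) = c) ∧ c ≠ a := by
    by_cases h : S.cross.lt = a
    · exact ⟨Fin.last m, S.cross.gt, fun y hy => S.code_gt (Fin.lt_last_iff_ne_last.2 hy),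
        fun e => hS (h.trans e.symm)⟩
    · exact ⟨0, S.cross.lt, fun y hy => S.code_lt (Fin.pos_iff_ne_zero.2 hy), h⟩
  refine two_pow_le_profile ℓ S z false fun w w' hw hw' σ hσ => ?_
  have hl : ∀ x, w' (σ x) = w x := by
    intro x
    cases hx : w x
    · by_contra hx'
      rw [Bool.not_eq_false] at hx'
      have := letter_of_high hℓ hc ha hac hw' hσ.symm (σ x) hx'
      simp [hx] at this
    · exact letter_of_high hℓ hc ha hac hw hσ x hx
  obtain rfl := perm_eq_one_of_letter hS hσ hl
  exact funext fun x => (hl x).symm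

/-! ### Partial matchings -/

/-- The vertices of `A` on the levels below `p.1` and the vertices of `B` on the levels in `p.2`. -/
def matchingSet (p : ℕ × Finset ℕ) : Finset (ℕ × Bool) :=
  (Finset.range p.1).map ⟨fun i => (i, false), Prod.mk_left_injective false⟩ ∪
    p.2.map ⟨fun i => (i, true), Prod.mk_left_injective true⟩

theorem mem_matchingSet_false {p : ℕ × Finset ℕ} {i : ℕ} :
    (i, false) ∈ matchingSet p ↔ i < p.1 := by
  simp [matchingSet]

theorem mem_matchingSet_true {p : ℕ × Finset ℕ} {i : ℕ} :
    (i, true) ∈ matchingSet p ↔ i ∈ p.2 := by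
  simp [matchingSet]

theorem card_matchingSet (p : ℕ × Finset ℕ) : (matchingSet p).card = p.1 + p.2.card := by
  rw [matchingSet, Finset.card_union_of_disjoint, Finset.card_map, Finset.card_map,
    Finset.card_range]
  rw [Finset.disjoint_left]
  rintro ⟨i, b⟩ h1 h2
  simp only [Finset.mem_map, Function.Embedding.coeFn_mk, Prod.mk.injEq] at h1 h2
  obtain ⟨_, _, _, rfl⟩ := h1
  obtain ⟨_, _, _, h⟩ := h2
  cases h

/-- The pairs `(k, T)` with `T ⊆ {0, …, k - 1}` and `k + |T| = n`. -/
def matchings (n : ℕ) : Finset (ℕ × Finset ℕ) :=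
  (Finset.HasAntidiagonal.antidiagonal n).biUnion fun q =>
    (Finset.powersetCard q.2 (Finset.range q.1)).map ⟨fun T => (q.1, T), Prod.mk_right_injective q.1⟩

theorem mem_matchings {n : ℕ} {p : ℕ × Finset ℕ} :
    p ∈ matchings n ↔ p.2 ⊆ Finset.range p.1 ∧ p.1 + p.2.card = n := by
  obtain ⟨k, T⟩ := p
  simp only [matchings, Finset.mem_biUnion, Finset.HasAntidiagonal.mem_antidiagonal, Finset.mem_map,
    Finset.mem_powersetCard, Function.Embedding.coeFn_mk, Prod.mk.injEq, Prod.exists]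
  constructor
  · rintro ⟨a, b, hab, T', ⟨hT, hc⟩, rfl, rfl⟩
    exact ⟨hT, by omega⟩
  · rintro ⟨hT, hc⟩
    exact ⟨k, T.card, hc, T, ⟨hT, rfl⟩, rfl, rfl⟩

theorem card_matchings (n : ℕ) : (matchings n).card = Nat.fib (n + 1) := by
  rw [Nat.fib_succ_eq_sum_choose, matchings, Finset.card_biUnion]
  · exact Finset.sum_congr rfl fun q _ => by simp
  · rintro ⟨a, b⟩ hab ⟨a', b'⟩ hab' hne
    rw [Function.onFun, Finset.disjoint_left]
    intro p h1 h2
    simp only [Finset.mem_map, Function.Embedding.coeFn_mk] at h1 h2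
    obtain ⟨_, _, rfl⟩ := h1
    obtain ⟨_, _, h⟩ := h2
    have e1 := Finset.HasAntidiagonal.mem_antidiagonal.1 (Finset.mem_coe.1 hab)
    have e2 := Finset.HasAntidiagonal.mem_antidiagonal.1 (Finset.mem_coe.1 hab')
    obtain rfl : a' = a := congrArg Prod.fst h
    exact hne (Prod.ext rfl (by simp only at e1 e2 ⊢; omega))

/-- The map `g` is an isomorphism from the structure induced on `matchingSet p` to the one induced on
`matchingSet q`. -/
structure MatchingIso (ℓ : ℕ) (S : Shape) (p q : ℕ × Finset ℕ) (g : ℕ × Bool → ℕ × Bool) :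
    Prop where
  bijOn : Set.BijOn g (matchingSet p) (matchingSet q)
  le_iff : ∀ x ∈ matchingSet p, ∀ y ∈ matchingSet p,
    (position ℓ x ≤ position ℓ y ↔ position ℓ (g x) ≤ position ℓ (g y))
  code_eq : ∀ x ∈ matchingSet p, ∀ y ∈ matchingSet p, S.code x y = S.code (g x) (g y)

section MatchingIso

variable {ℓ : ℕ} {S : Shape} {p q : ℕ × Finset ℕ} {g : ℕ × Bool → ℕ × Bool}

theorem MatchingIso.symm (h : MatchingIso ℓ S p q g) :
    ∃ g', MatchingIso ℓ S q p g' ∧ ∀ x ∈ matchingSet p, g' (g x) = x := by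
  have hinv := h.bijOn.invOn_invFunOn
  have hmaps : ∀ x ∈ matchingSet q, Function.invFunOn g (matchingSet p) x ∈ matchingSet p :=
    fun x hx => (h.bijOn.symm hinv.symm).mapsTo hx
  refine ⟨_, ⟨h.bijOn.symm hinv.symm, ?_, ?_⟩, fun x hx => hinv.1 hx⟩
  · intro x hx y hy
    have := h.le_iff _ (hmaps x hx) _ (hmaps y hy)
    rw [hinv.2 hx, hinv.2 hy] at this
    exact this.symm
  · intro x hx y hy
    have := h.code_eq _ (hmaps x hx) _ (hmaps y hy)
    rw [hinv.2 hx, hinv.2 hy] at this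
    exact this.symm

/-- An isomorphism that preserves the letters restricts to an isomorphism of the orders of the vertices
of `A`, and is therefore the identity on them. -/
theorem MatchingIso.map_false (h : MatchingIso ℓ S p q g)
    (hl : ∀ x ∈ matchingSet p, (g x).2 = x.2) :
    p.1 = q.1 ∧ ∀ i < p.1, g (i, false) = (i, false) := by
  have hg : ∀ i : Fin p.1, g (i, false) = ((g (i, false)).1, false) := fun i =>
    Prod.ext rfl (hl _ (mem_matchingSet_false.2 i.2))
  have hlt : ∀ i : Fin p.1, (g (i, false)).1 < q.1 := fun i => by
    have := h.bijOn.mapsTo (mem_matchingSet_false.2 i.2)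
    rw [hg i] at this
    exact mem_matchingSet_false.1 this
  let f : Fin p.1 → Fin q.1 := fun i => ⟨_, hlt i⟩
  have hgf : ∀ i : Fin p.1, g (i, false) = ((f i : ℕ), false) := hg
  have hinj : Function.Injective f := fun i j hij => by
    have := h.bijOn.injOn (mem_matchingSet_false.2 i.2) (mem_matchingSet_false.2 j.2)
      (by rw [hgf, hgf, hij])
    exact Fin.ext (congrArg Prod.fst this)
  have hsurj : Function.Surjective f := fun j => by
    obtain ⟨⟨i, b⟩, hx, hxj⟩ := h.bijOn.surjOn (mem_matchingSet_false.2 j.2)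
    have hb := hl _ hx
    rw [hxj] at hb
    subst hb
    have hi := mem_matchingSet_false.1 hx
    exact ⟨⟨i, hi⟩, Fin.ext (congrArg Prod.fst ((hgf ⟨i, hi⟩).symm.trans hxj))⟩
  have hmono : StrictMono f := fun i j hij => by
    refine lt_of_le_of_ne ?_ (hinj.ne hij.ne)
    have hi := mem_matchingSet_false.2 i.2
    have hj := mem_matchingSet_false.2 j.2
    have h3 := h.le_iff _ hi _ hj
    have h4 := h.le_iff _ hj _ hi
    rw [hgf, hgf] at h3 h4
    rcases position_same ℓ false with h | h <;> rw [h, h] at h3 h4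
    · exact Fin.le_def.2 (h3.1 hij.le)
    · exact Fin.le_def.2 (h4.1 hij.le)
  have hpq : p.1 = q.1 := by simpa using Fintype.card_of_bijective ⟨hinj, hsurj⟩
  refine ⟨hpq, fun i hi => (hgf ⟨i, hi⟩).trans (Prod.ext ?_ rfl)⟩
  have h5 : f = Fin.cast hpq := (StrictMono.range_inj hmono (Fin.cast_strictMono hpq)).1
    (hsurj.range_eq.trans (finCongr hpq).surjective.range_eq.symm)
  rw [h5]
  rfl

end MatchingIso

/-- If isomorphisms preserve the letters, and the vertex of `B` matched with a given vertex of `A` can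
be recognized, the structures induced on the sets `matchingSet p` are pairwise non-isomorphic. -/
theorem fib_le_profile (ℓ : ℕ) (S : Shape) (n : ℕ)
    (hl : ∀ p ∈ matchings n, ∀ q ∈ matchings n, ∀ g, MatchingIso ℓ S p q g →
      ∀ x ∈ matchingSet p, (g x).2 = x.2)
    (hm : ∀ i j, (position ℓ (i, false) ≤ position ℓ (i, true) ↔
      position ℓ (i, false) ≤ position ℓ (j, true)) →
      S.code (i, false) (i, true) = S.code (i, false) (j, true) → j = i) :
    Nat.fib (n + 1) ≤ (S.plain ℓ).profile n := by
  rw [← card_matchings]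
  refine (S.plain ℓ).card_le_profile n (matchings n) matchingSet
    (fun p hp => (card_matchingSet p).trans (mem_matchings.1 hp).2) ?_
  intro p hp q hq hpq
  obtain ⟨g, hg, h⟩ := hpq.exists_bijOn
  have hiso : MatchingIso ℓ S p q g :=
    ⟨hg, fun x hx y hy => (h x hx y hy).1, fun x hx y hy =>
      Prod.ext (Bool.eq_iff_iff.2 (h x hx y hy).2) (Bool.eq_iff_iff.2 (h y hy x hx).2)⟩
  have hlet := hl p hp q hq g hiso
  obtain ⟨hk, hA⟩ := hiso.map_false hlet
  have hp' := mem_matchings.1 hp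
  have hq' := mem_matchings.1 hq
  refine Prod.ext hk (Finset.eq_of_subset_of_card_le (fun i hi => ?_) (by omega))
  have hi1 : i < p.1 := Finset.mem_range.1 (hp'.1 hi)
  have hiA := mem_matchingSet_false.2 hi1
  have hiB := mem_matchingSet_true.2 hi
  have hgB : g (i, true) = ((g (i, true)).1, true) := Prod.ext rfl (hlet _ hiB)
  have h1 := hiso.le_iff _ hiA _ hiB
  have h2 := hiso.code_eq _ hiA _ hiB
  have h3 := hg.mapsTo hiB
  rw [hA i hi1, hgB] at h1 h2
  rw [hgB, hm i _ h1 h2] at h3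
  exact mem_matchingSet_true.1 h3

/-- In the interleaved orders, if all increasing pairs have the code `α` except for the matched ones,
then the vertices of `B` are those that end a pair of code `S.cross.eq`. -/
theorem fib_le_profile_of_low {ℓ : ℕ} (hℓ : ℓ = 1 ∨ ℓ = 2) (S : Shape)
    (h1 : S.sideA = S.cross.lt) (h2 : S.sideB = S.cross.lt) (h3 : S.cross.gt.swap = S.cross.lt)
    (hu : S.cross.eq ≠ S.cross.lt) (n : ℕ) : Nat.fib (n + 1) ≤ (S.plain ℓ).profile n := by
  let key : ℕ × Bool → ℕ := fun x => 2 * x.1 + x.2.toNat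
  have hR : ∀ x y, key x < key y → S.code x y = S.cross.eq →
      x.1 = y.1 ∧ x.2 = false ∧ y.2 = true := by
    rintro ⟨i, b⟩ ⟨j, c⟩ hlt hc
    rcases lt_trichotomy i j with hij | rfl | hij
    · exfalso
      refine hu (hc.symm.trans ?_)
      cases b <;> cases c
      · rw [S.code_false_false hij, h1]
      · rw [S.code_lt hij]
      · rw [← S.code_swap, S.code_gt hij, h3]
      · rw [S.code_true_true hij, h2]
    · cases b <;> cases c <;> simp [key] at hlt ⊢
    · have := Bool.toNat_le c
      simp only [key] at hlt
      omega
  have hR' : ∀ i, key (i, false) < key (i, true) := by simp [key]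
  refine fib_le_profile ℓ S n (fun p hp q hq g hg => ?_) fun i j hle hc => ?_
  · have hk : ∀ x ∈ matchingSet p, ∀ y ∈ matchingSet p, (key x < key y ↔ key (g x) < key (g y)) := by
      intro x hx y hy
      have e1 := hg.le_iff x hx y hy
      have e2 := hg.le_iff y hy x hx
      rw [← not_le, ← not_le]
      rcases hℓ with rfl | rfl
      · rw [position_one_le_iff, position_one_le_iff] at e2
        exact not_congr e2
      · rw [position_two_le_iff, position_two_le_iff] at e1
        exact not_congr e1
    have hB : ∀ p ∈ matchings n, ∀ i, (i, true) ∈ matchingSet p → (i, false) ∈ matchingSet p :=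
      fun p hp i hi => mem_matchingSet_false.2 (Finset.mem_range.1
        ((mem_matchings.1 hp).1 (mem_matchingSet_true.1 hi)))
    rintro ⟨i, b⟩ hx
    cases b
    · rw [← Bool.not_eq_true]
      intro hgx
      have hgx' : g (i, false) = ((g (i, false)).1, true) := Prod.ext rfl hgx
      have hm := hg.bijOn.mapsTo hx
      rw [hgx'] at hm
      obtain ⟨y, hy, hgy⟩ := hg.bijOn.surjOn (hB q hq _ hm)
      have e1 : key y < key (i, false) := by
        rw [hk y hy _ hx, hgy, hgx']
        exact hR' _
      have e2 : S.code y (i, false) = S.cross.eq := by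
        rw [hg.code_eq y hy _ hx, hgy, hgx']
        exact S.code_eq
      exact Bool.false_ne_true (hR _ _ e1 e2).2.2
    · have hy := hB p hp i hx
      refine (hR (g (i, false)) (g (i, true)) ((hk _ hy _ hx).1 (hR' i)) ?_).2.2
      rw [← hg.code_eq _ hy _ hx]
      exact S.code_eq
  · rw [S.code_eq] at hc
    refine (hR (i, false) (j, true) ?_ hc.symm).1.symm
    rcases hℓ with rfl | rfl
    · rw [position_one_le_iff, position_one_le_iff] at hle
      simp [key] at hle ⊢
      omega
    · rw [position_two_le_iff, position_two_le_iff] at hle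
      simp [key] at hle ⊢
      omega

/-- Let `A` precede `B`, and let the code of a vertex of `A` and a vertex of `B` tell precisely whether
they are matched. An isomorphism that moved a vertex `y` of `B` into `A` would move all of `A` into
`A`, so all vertices of `A` would have the same code to `y`; this fails if `y` is matched with one of
them and not with another. -/
theorem MatchingIso.letter_of_high {ℓ : ℕ} (hℓ : 3 ≤ ℓ) {S : Shape}
    (hS : S.cross.lt = S.cross.gt) (hu : S.cross.eq ≠ S.cross.lt) {n : ℕ} (hn : n ≠ 2)
    {p q : ℕ × Finset ℕ} (hp : p ∈ matchings n) {g : ℕ × Bool → ℕ × Bool}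
    (h : MatchingIso ℓ S p q g) (y : ℕ) (hy : (y, true) ∈ matchingSet p) :
    (g (y, true)).2 = true := by
  by_contra hgy
  rw [Bool.not_eq_true] at hgy
  obtain ⟨a, ha⟩ := exists_code_sideA ℓ S
  have hp' := mem_matchings.1 hp
  have hyT := mem_matchingSet_true.1 hy
  have hyk := Finset.mem_range.1 (hp'.1 hyT)
  have key : ∀ i < p.1, S.code (i, false) (y, true) = a := by
    intro i hi
    have hx := mem_matchingSet_false.2 hi
    have hle := (h.le_iff _ hx _ hy).1 (position_false_le_true hℓ i y)
    have hgy' : g (y, true) = ((g (y, true)).1, false) := Prod.ext rfl hgy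
    have hgx : (g (i, false)).2 = false := by
      rw [← Bool.not_eq_true]
      intro hgx
      have hgx' : g (i, false) = ((g (i, false)).1, true) := Prod.ext rfl hgx
      rw [hgx', hgy'] at hle
      exact position_not_true_le_false hℓ _ _ hle
    have hgx' : g (i, false) = ((g (i, false)).1, false) := Prod.ext rfl hgx
    have hne : g (i, false) ≠ g (y, true) := fun e => by
      simpa using h.bijOn.injOn hx hy e
    rw [h.code_eq _ hx _ hy]
    rw [hgx', hgy'] at hle hne ⊢
    exact ha _ _ (fun e => hne (by rw [e])) hle
  have hcard : p.2.card ≤ p.1 := by simpa using Finset.card_le_card hp'.1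
  have hpos : 0 < p.2.card := Finset.card_pos.2 ⟨y, hyT⟩
  obtain ⟨i, hi, hiy⟩ : ∃ i < p.1, i ≠ y := by
    by_cases h0 : y = 0
    · exact ⟨1, by omega, by omega⟩
    · exact ⟨0, by omega, by omega⟩
  have e1 := key y hyk
  have e2 := key i hi
  rw [S.code_eq] at e1
  rcases hiy.lt_or_gt with h' | h'
  · rw [S.code_lt h'] at e2
    exact hu (e1.trans e2.symm)
  · rw [S.code_gt h', ← hS] at e2
    exact hu (e1.trans e2.symm)

/-- A matched and an unmatched pair of a vertex of `A` and a vertex of `B`. -/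
theorem two_le_profile_of_high {ℓ : ℕ} (hℓ : 3 ≤ ℓ) {S : Shape}
    (hu : S.cross.eq ≠ S.cross.lt) : 2 ≤ (S.plain ℓ).profile 2 := by
  have := (S.plain ℓ).card_le_profile_of_enum (ι := Fin 2) 2
    (fun b => ![(0, false), ((b : ℕ), true)]) ?_ ?_
  · simpa using this
  · intro b x y hxy
    fin_cases x <;> fin_cases y <;> first | rfl | cases congrArg Prod.snd hxy
  · intro b c σ h1 h2
    have hσ : σ = 1 := by
      refine perm_eq_one_of_strictMono σ ?_
      have h4 : ∀ x : Fin 2, x = 0 ∨ x = 1 := by decide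
      have h01 : σ 0 ≠ σ 1 := fun e => by simpa using σ.injective e
      have h3 := (h1 0 1).1 (position_false_le_true hℓ 0 b)
      rw [Fin.strictMono_iff_lt_succ]
      intro i
      obtain rfl : i = 0 := Subsingleton.elim _ _
      rcases h4 (σ 0) with h5 | h5 <;> rcases h4 (σ 1) with h6 | h6
      · exact absurd (h5.trans h6.symm) h01
      · simp [h5, h6]
      · rw [h5, h6] at h3
        exact absurd h3 (position_not_true_le_false hℓ _ _)
      · exact absurd (h5.trans h6.symm) h01
    subst hσ
    have h3 : S.code (0, false) ((b : ℕ), true) = S.code (0, false) ((c : ℕ), true) :=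
      Prod.ext (Bool.eq_iff_iff.2 (h2 0 1)) (Bool.eq_iff_iff.2 (h2 1 0))
    have hu' : S.code (0, false) (0, true) ≠ S.code (0, false) (1, true) := by
      rwa [S.code_eq, S.code_lt Nat.zero_lt_one]
    fin_cases b <;> fin_cases c
    · rfl
    · exact absurd h3 hu'
    · exact absurd h3.symm hu'
    · rfl

/-- If `A` precedes `B` and the codes from `A` to `B` tell precisely which vertices are matched, the
matchings are distinguished. -/
theorem fib_le_profile_of_high {ℓ : ℕ} (hℓ : 3 ≤ ℓ) (S : Shape)
    (hS : S.cross.lt = S.cross.gt) (hu : S.cross.eq ≠ S.cross.lt) (n : ℕ) :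
    Nat.fib (n + 1) ≤ (S.plain ℓ).profile n := by
  by_cases hn : n = 2
  · subst hn
    exact two_le_profile_of_high hℓ hu
  refine fib_le_profile ℓ S n (fun p hp q hq g hg => ?_) fun i j _ hc => ?_
  · rintro ⟨i, b⟩ hx
    cases b
    · obtain ⟨g', hg', hinv⟩ := hg.symm
      rw [← Bool.not_eq_true]
      intro hgx
      have hgx' : g (i, false) = ((g (i, false)).1, true) := Prod.ext rfl hgx
      have hm := hg.bijOn.mapsTo hx
      rw [hgx'] at hm
      have := hg'.letter_of_high hℓ hS hu hn hq _ hm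
      rw [← hgx', hinv _ hx] at this
      exact Bool.false_ne_true this
    · exact hg.letter_of_high hℓ hS hu hn hp i hx
  · by_contra hij
    rw [S.code_eq] at hc
    rcases Ne.lt_or_gt hij with h | h
    · rw [S.code_gt h, ← hS] at hc
      exact hu hc
    · rw [S.code_lt h] at hc
      exact hu hc

/-! ### Structures with an additional vertex -/

/-- The structure on `{a} ∪ ℕ × {0,1}` of a shape, with the codes `c` for the vertex `a`. -/
def Shape.withApex (ℓ : ℕ) (S : Shape) (c : Code × Code) : ReflOrdDigraph where
  V := Option (ℕ × Bool)
  le := fun x y => positionApex ℓ x ≤ positionApex ℓ y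
  le_refl := fun _ => le_rfl
  le_trans := fun _ _ _ => le_trans
  le_antisymm := fun _ _ h h' => positionApex_injective ℓ (le_antisymm h h')
  le_total := fun _ _ => le_total _ _
  edge := fun x y => S.edgeApex c x y = true
  edge_refl := by rintro (_ | ⟨n, _ | _⟩) <;> simp [Shape.edgeApex, Shape.edge, edgeBool]

theorem Shape.toDigraph_eq_withApex (ℓ : ℕ) {S : Shape} {c : Code × Code} (h : S.apex = some c) :
    S.toDigraph ℓ = S.withApex ℓ c := by
  obtain ⟨α, β, X, e⟩ := S
  subst h
  rfl

/-- The vertex `a` followed by the vertices of a word. -/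
def apexWord {m : ℕ} (w : Fin m → Bool) : Fin (m + 1) → Option (ℕ × Bool) :=
  Fin.cons none fun i => some ((i : ℕ), w i)

theorem apexWord_le_iff_one {m : ℕ} (w : Fin m → Bool) (x y : Fin (m + 1)) :
    positionApex 1 (apexWord w x) ≤ positionApex 1 (apexWord w y) ↔ x ≤ y := by
  cases x using Fin.cases with
  | zero =>
    cases y using Fin.cases with
    | zero => simp
    | succ j => cases h : w j <;> simp [apexWord, positionApex, position, Prod.Lex.toLex_le_toLex, h]
  | succ i =>
    cases y using Fin.cases with
    | zero => cases h : w i <;> simp [apexWord, positionApex, position, Prod.Lex.toLex_le_toLex, h]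
    | succ j =>
      simp only [apexWord, Fin.cons_succ, positionApex, position_one_le_iff, Fin.succ_le_succ_iff]
      have b1 := Bool.toNat_le (w i)
      have b2 := Bool.toNat_le (w j)
      rcases lt_trichotomy i j with h | rfl | h
      · have := Fin.lt_def.1 h
        exact iff_of_true (by omega) h.le
      · simp
      · have := Fin.lt_def.1 h
        exact iff_of_false (by omega) h.not_ge

theorem apexWord_le_iff_two {m : ℕ} (w : Fin m → Bool) (x y : Fin (m + 1)) :
    positionApex 2 (apexWord w x) ≤ positionApex 2 (apexWord w y) ↔ y ≤ x := by
  cases x using Fin.cases with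
  | zero =>
    cases y using Fin.cases with
    | zero => simp
    | succ j => cases h : w j <;> simp [apexWord, positionApex, position, Prod.Lex.toLex_le_toLex, h]
  | succ i =>
    cases y using Fin.cases with
    | zero => cases h : w i <;> simp [apexWord, positionApex, position, Prod.Lex.toLex_le_toLex, h]
    | succ j =>
      simp only [apexWord, Fin.cons_succ, positionApex, position_two_le_iff, Fin.succ_le_succ_iff]
      have b1 := Bool.toNat_le (w i)
      have b2 := Bool.toNat_le (w j)
      rcases lt_trichotomy i j with h | rfl | h
      · have := Fin.lt_def.1 h
        exact iff_of_false (by omega) h.not_ge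
      · simp
      · have := Fin.lt_def.1 h
        exact iff_of_true (by omega) h.le

/-- The vertex `a` is the first in the order of the levels, and its codes distinguish the letters, so
all words are distinguished. -/
theorem two_pow_le_profile_of_apex {ℓ : ℕ} (hℓ : ℓ = 1 ∨ ℓ = 2) (S : Shape) {c : Code × Code}
    (hc : c.1 ≠ c.2) (m : ℕ) : 2 ^ m ≤ (S.withApex ℓ c).profile (m + 1) := by
  have hiff : ∀ (w : Fin m → Bool) (x y : Fin (m + 1)),
      (positionApex ℓ (apexWord w x) ≤ positionApex ℓ (apexWord w y) ↔
        if ℓ = 1 then x ≤ y else y ≤ x) := by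
    intro w x y
    rcases hℓ with rfl | rfl
    · simpa using apexWord_le_iff_one w x y
    · simpa using apexWord_le_iff_two w x y
  have := (S.withApex ℓ c).card_le_profile_of_enum (ι := Fin m → Bool) (m + 1) apexWord ?_ ?_
  · simpa using this
  · intro w x y hxy
    have h1 := (hiff w x y).1 (by rw [hxy])
    have h2 := (hiff w y x).1 (by rw [hxy])
    split_ifs at h1 h2
    · exact le_antisymm h1 h2
    · exact le_antisymm h2 h1
  · intro w w' σ h1 h2
    have hσ : σ = 1 := by
      refine perm_eq_one_of_strictMono σ (Monotone.strictMono_of_injective ?_ σ.injective)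
      intro x y hxy
      have e1 := (hiff w x y).symm.trans ((h1 x y).trans (hiff w' _ _))
      have e2 := (hiff w y x).symm.trans ((h1 y x).trans (hiff w' _ _))
      split_ifs at e1 e2
      · exact e1.1 hxy
      · exact e2.1 hxy
    subst hσ
    funext i
    have e1 := Bool.eq_iff_iff.2 (h2 0 i.succ)
    have e2 := Bool.eq_iff_iff.2 (h2 i.succ 0)
    simp only [apexWord, Fin.cons_zero, Fin.cons_succ, Equiv.Perm.one_apply] at e1 e2
    cases h5 : w i <;> cases h6 : w' i <;> rw [h5, h6] at e1 e2
    · exact absurd (Prod.ext e1 e2) hc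
    · exact absurd (Prod.ext e1.symm e2.symm) hc

/-! ### The list of structures -/

/-- The condition shared by all structures of the list: if there is a vertex `a`, it distinguishes `A`
from `B`; otherwise, in the interleaved orders (`low = true`), the codes of the increasing pairs are
not all equal, and in the other orders, where `A` precedes `B`, the codes from `A` to `B` are not all
equal. -/
def Shape.varied (low : Bool) (S : Shape) : Bool :=
  match S.apex with
  | some c => low && c.1 != c.2
  | none =>
    if low then
      !(S.sideA == S.cross.lt && S.sideB == S.cross.lt && S.cross.gt.swap == S.cross.lt &&
        S.cross.eq == S.cross.lt)
    else !(S.cross.lt == S.cross.gt && S.cross.eq == S.cross.lt)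

theorem fib_le_of_two_pow_le {G : ReflOrdDigraph} (h : ∀ m, 2 ^ m ≤ G.profile (m + 1)) (n : ℕ) :
    Nat.fib (n + 1) ≤ G.profile n := by
  cases n with
  | zero =>
    exact G.card_le_profile (ι := Unit) 0 {()} (fun _ => ∅) (by simp) fun _ _ _ _ _ => rfl
  | succ m => exact (fib_le_two_pow m).trans (h m)

/-- In the interleaved orders, if two codes of increasing pairs on different levels are distinct, a
vertex on the lowest or on the highest level distinguishes the letters of a word; otherwise the matched
pairs are distinguished by their code. -/
theorem fib_le_profile_of_varied_low {ℓ : ℕ} (hℓ : ℓ = 1 ∨ ℓ = 2) {S : Shape}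
    (hS : S.varied true = true) (n : ℕ) : Nat.fib (n + 1) ≤ (S.toDigraph ℓ).profile n := by
  cases hc : S.apex with
  | some c =>
    rw [S.toDigraph_eq_withApex ℓ hc]
    have hne : c.1 ≠ c.2 := by simpa [Shape.varied, hc] using hS
    exact fib_le_of_two_pow_le (two_pow_le_profile_of_apex hℓ S hne) n
  | none =>
    rw [S.toDigraph_eq_plain ℓ hc]
    by_cases h1 : S.sideA = S.cross.lt
    · by_cases h3 : S.cross.gt.swap = S.cross.lt
      · by_cases h2 : S.sideB = S.cross.lt
        · have hu : S.cross.eq ≠ S.cross.lt := by simpa [Shape.varied, hc, h1, h2, h3] using hS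
          exact fib_le_profile_of_low hℓ S h1 h2 h3 hu n
        · -- The vertex of `B` on the lowest level distinguishes the letters.
          refine fib_le_of_two_pow_le (fun m => two_pow_le_profile_of_low hℓ S 0 true ?_) n
          intro i hi
          have hi' : ((0 : Fin (m + 1)) : ℕ) < i := Fin.pos_iff_ne_zero.2 hi
          rw [← S.code_swap, S.code_gt hi', S.code_true_true hi', h3]
          exact Ne.symm h2
      · -- The vertex of `A` on the highest level distinguishes the letters.
        refine fib_le_of_two_pow_le
          (fun m => two_pow_le_profile_of_low hℓ S (Fin.last m) false ?_) n
        intro i hi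
        have hi' : (i : ℕ) < Fin.last m := Fin.lt_last_iff_ne_last.2 hi
        rw [← S.code_swap, S.code_false_false hi', S.code_gt hi', h1]
        exact fun e => h3 (by rw [← e, Prod.swap_swap])
    · -- The vertex of `A` on the lowest level distinguishes the letters.
      refine fib_le_of_two_pow_le (fun m => two_pow_le_profile_of_low hℓ S 0 false ?_) n
      intro i hi
      have hi' : ((0 : Fin (m + 1)) : ℕ) < i := Fin.pos_iff_ne_zero.2 hi
      rwa [S.code_false_false hi', S.code_lt hi']

theorem fib_le_profile_of_varied_high {ℓ : ℕ} (hℓ : 3 ≤ ℓ) {S : Shape}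
    (hS : S.varied false = true) (n : ℕ) : Nat.fib (n + 1) ≤ (S.toDigraph ℓ).profile n := by
  cases hc : S.apex with
  | some c => simp [Shape.varied, hc] at hS
  | none =>
    rw [S.toDigraph_eq_plain ℓ hc]
    by_cases h : S.cross.lt = S.cross.gt
    · have hu : S.cross.eq ≠ S.cross.lt := by
        intro hu
        simp [Shape.varied, hc, ← h, hu] at hS
      exact fib_le_profile_of_high hℓ S h hu n
    · exact fib_le_of_two_pow_le (two_pow_le_profile_of_high hℓ S h) n

theorem shapeLow_varied : ∀ p ∈ Finset.Icc 1 10, ∀ k ∈ Finset.Icc 1 (count p 1),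
    (shapeLow p k).varied true = true := by
  decide

theorem shapeHigh_varied : ∀ p ∈ Finset.Icc 1 10, ∀ k ∈ Finset.Icc 1 (count p 3),
    (shapeHigh p k).varied false = true := by
  decide

theorem fib_le_profile_member {p ℓ k : ℕ} (h : (p, ℓ, k) ∈ indices) (n : ℕ) :
    Nat.fib (n + 1) ≤ (member p ℓ k).profile n := by
  simp only [indices, Finset.mem_biUnion, Finset.mem_image, Prod.mk.injEq] at h
  obtain ⟨p, hp, ℓ, hℓ, k, hk, rfl, rfl, rfl⟩ := h
  rw [Finset.mem_Icc] at hℓ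
  by_cases hl : ℓ ≤ 2
  · have hcount : count p ℓ = count p 1 := by simp [count, hl]
    rw [hcount] at hk
    rw [member, if_pos hl]
    exact fib_le_profile_of_varied_low (by omega) (shapeLow_varied p hp k hk) n
  · have hcount : count p ℓ = count p 3 := by simp [count, hl]
    rw [hcount] at hk
    rw [member, if_neg hl]
    exact fib_le_profile_of_varied_high (by omega) (shapeHigh_varied p hp k hk) n

end OrdProfile

theorem mainTheorem4 (G : OrdProfile.ReflOrdDigraph) (hG : G ∈ OrdProfile.basis) :
    ∃ φ : ℕ → ℕ, ∃ n₀ : ℕ, (φ, n₀) ∈ OrdProfile.comparison ∧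
      ((∀ n, n₀ ≤ n → G.profile n = φ n) ∨ (∀ n, n₀ ≤ n → φ n ≤ G.profile n)) := by
  obtain ⟨p, ℓ, k, h, rfl⟩ := hG
  refine ⟨fun n => Nat.fib (n + 1), 0, ?_, Or.inr fun n _ => OrdProfile.fib_le_profile_member h n⟩
  simp [OrdProfile.comparison]
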